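/- A \emph{trinity} is a triangulation (multiple edges allowed) of a closed oriented surface whose vertices are colored red, green and blue so that no edge joins vertices of the same color; edges carry the color missing at their ends. A triangle is black if its vertices are blue, green, red in clockwise order, and white otherwise. A \emph{planar trinity} is a trinity on the sphere with a chosen outer white triangle, whose vertices are called roots. A \emph{state} is a perfect matching between the non-outer white triangles and the non-root vertices in which matched pairs are incident. For a color $c$, let $G_c^*$ be the directed graph (embedded in the sphere) on the vertices of color $c$, with one arrow for each white triangle $w$: it starts at the vertex of color $c$ of the black triangle that shares the edge of color $c$ with $w$, crosses that edge, and ends at the vertex of color $c$ of $w$. In a state, the arrows of those $w$ that are matched to their vertex of color $c$ form a spanning arborescence of $G_c^*$ rooted at the root of color $c$, called the constituent of color $c$. The \emph{clocked arborescence} of $G_c^*$ is the output of the following greedy search. Start at the root of color $c$, in the outer white triangle, and turn counter-clockwise about the current vertex. When the tail end of an arrow is met whose head has not been reached yet, select the arrow, move along it to its head, and continue turning counter-clockwise there. After a full turn at a non-root vertex, go back along the selected arrow that leads to it and continue turning at its tail; stop after a full turn at the root. A \emph{clockwise move} on a state is possible if there are a red, a green and a blue edge that form a closed path through one vertex of each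 color and surround a disk not containing the three white triangles adjacent to these edges, so that the white triangles at the red, green and blue edge are matched to the green, blue and red vertex of the path, respectively. The move rematches these triangles to the blue, red and green vertex of the path, respectively, and leaves the rest of the state unchanged. (If the disk is a single black triangle, this is the move about a clockwise empty black triangle.) \textbf{Proposition.} Let $s$ be a state of a planar trinity. If for some color $c$ the constituent spanning arborescence of color $c$ of $s$ is not the clocked arborescence of $G_c^*$, then $s$ admits a clockwise move. -/

import Mathlib

/-- The three colours of vertices (and of edges) of a trinity. -/
inductive Color
  | red
  | green
  | blue

/-- The cyclic permutation red → green → blue → red. -/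
def Color.next : Color → Color
  | red => green
  | green => blue
  | blue => red

/-- The cyclic permutation red → blue → green → red. -/
def Color.prev : Color → Color
  | red => blue
  | green => red
  | blue => green

/-- A trinity (properly three-coloured triangulation of a closed oriented surface), as a
combinatorial map. `W` and `B` are the sets of white and black triangles. Every edge lies between
a white and a black triangle, and every triangle has one edge of each colour (the colour that does
not occur at the ends of the edge). So the surface is glued from the triangles according to three
bijections: `edge c w` is the black triangle on the other side of the colour `c` edge of `w`.
The edges of colour `c` are thereby indexed by the white triangles.

Orientation: the vertices (and likewise the edges) of a black triangle are blue, green, red in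
clockwise order, those of a white triangle are blue, green, red in counter-clockwise order. -/
structure Trinity (W B : Type*) where
  edge : Color → W ≃ B

namespace Trinity

variable {W B : Type*} (T : Trinity W B)

/-- Counter-clockwise rotation, among the white triangles, about their vertices of colour `c`:
from a white triangle one first crosses its edge of colour `c.prev` and gets to a black triangle,
then one crosses the edge of colour `c.next` of that black triangle. -/
def rot (c : Color) : Equiv.Perm W :=
  (T.edge c.prev).trans (T.edge c.next).symm

/-- The vertices of colour `c`: the cycles of the rotation `rot c`. -/
def ColorVertex (c : Color) : Type _ :=
  Quotient (Equiv.Perm.SameCycle.setoid (T.rot c))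

/-- All vertices. -/
def Vertex : Type _ := Σ c : Color, T.ColorVertex c

/-- The vertex of colour `c` of a white triangle. -/
def vertex (c : Color) (w : W) : T.Vertex :=
  ⟨c, Quotient.mk (Equiv.Perm.SameCycle.setoid (T.rot c)) w⟩

/-- The surface is connected: any two triangles are joined by a chain of adjacent triangles. -/
def Connected : Prop :=
  ∀ t t' : W ⊕ B,
    Relation.EqvGen (fun x y => ∃ c w, x = Sum.inl w ∧ y = Sum.inr (T.edge c w)) t t'

/-- The Euler characteristic: vertices minus edges plus triangles. -/
noncomputable def eulerChar : ℤ :=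
  (Nat.card T.Vertex : ℤ) - (Nat.card (Color × W) : ℤ) + (Nat.card (W ⊕ B) : ℤ)

/-! ### The directed ribbon graph `G_c^*`

Its vertices are the vertices of colour `c`. Its arrows are dual to the edges of colour `c` and so
they are indexed by the white triangles, too: the arrow `w` starts at the vertex of colour `c` of
the black triangle `edge c w`, crosses the common edge of colour `c`, and ends at the vertex of
colour `c` of `w`. As every triangle has exactly one vertex of colour `c`, the ends of arrows are
indexed by the triangles: `Sum.inl w` is the head end of the arrow `w`, and `Sum.inr b` is the tail
end of the arrow that starts in the black triangle `b`. -/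

/-- The arrow of `G_c^*` to which an end belongs. -/
def arrowOf (c : Color) : W ⊕ B → W
  | Sum.inl w => w
  | Sum.inr b => (T.edge c).symm b

/-- The opposite end of the same arrow of `G_c^*`. -/
def opp (c : Color) : W ⊕ B → W ⊕ B
  | Sum.inl w => Sum.inr (T.edge c w)
  | Sum.inr b => Sum.inl ((T.edge c).symm b)

/-- The next end of an arrow of `G_c^*` in the counter-clockwise direction about the same
vertex of colour `c`. -/
def ccw (c : Color) : W ⊕ B → W ⊕ B
  | Sum.inl w => Sum.inr (T.edge c.prev w)
  | Sum.inr b => Sum.inl ((T.edge c.next).symm b)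

end Trinity

/-- A planar trinity: a (finite) trinity on the sphere with a fixed outer white triangle. -/
structure PlanarTrinity (W B : Type*) extends Trinity W B where
  finite_white : Finite W
  connected : toTrinity.Connected
  sphere : toTrinity.eulerChar = 2
  outer : W

namespace PlanarTrinity

variable {W B : Type*} (T : PlanarTrinity W B)

/-- A state (Tutte matching): a perfect matching between the non-outer white triangles and the
non-root vertices, such that matched pairs are incident. -/
structure State where
  matching : {w : W // w ≠ T.outer} ≃ {x : T.Vertex // ∀ c, x ≠ T.vertex c T.outer}
  incident : ∀ w, ∃ c, (matching w).1 = T.vertex c w.1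

variable {T} in
/-- The constituent of colour `c` of a state, as a set of arrows of `G_c^*`: all `w` that are
matched to their vertex of colour `c`. -/
def State.arrows (s : T.State) (c : Color) : Set W :=
  {w | ∃ h : w ≠ T.outer, (s.matching ⟨w, h⟩).1 = T.vertex c w}

/-- The arrows that the greedy search selects in `G_c^*`, when it is at the end `d` and the arrows
in `S` have been selected so far: `w` gets selected if `d` is its tail end and its head is neither
the root nor the head of a previously selected arrow (so that no cycle is created). -/
def selected (c : Color) (d : W ⊕ B) (S : Set W) : Set W :=
  {w | d = Sum.inr (T.edge c w) ∧ T.vertex c w ≠ T.vertex c T.outer ∧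
    ∀ u ∈ S, T.vertex c w ≠ T.vertex c u}

open Classical in
/-- One step of the greedy search. If the arrow at the current end has just been selected, or was
selected before (in which case the search backtracks), then the search moves along it and turns on
counter-clockwise at its other end. Otherwise it just turns on counter-clockwise. -/
noncomputable def greedyStep (c : Color) (p : (W ⊕ B) × Set W) : (W ⊕ B) × Set W :=
  let S := p.2 ∪ T.selected c p.1 p.2
  (if T.arrowOf c p.1 ∈ S then T.ccw c (T.opp c p.1) else T.ccw c p.1, S)

/-- The clocked arborescence of `G_c^*`: all arrows that are selected by the greedy search, which
starts at the root of colour `c`, in the outer white triangle. -/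
def clocked (c : Color) : Set W :=
  {w | ∃ k : ℕ, w ∈ ((T.greedyStep c)^[k] (Sum.inl T.outer, ∅)).2}

/-- Three edges, namely for each colour `c` the edge of colour `c` of the white triangle `w c`,
form a closed path through a red, a green and a blue vertex: the ends of the edge of colour `c` are
the vertices of the other two colours of `w c`, and for each colour the two ends coincide. -/
def IsTriangle (w : Color → W) : Prop :=
  ∀ c : Color, T.vertex c (w c.next) = T.vertex c (w c.prev)

/-- The set `D` of triangles is a region that is bounded by the three edges above and that does not
contain the white triangles `w c`. If the three edges form a closed path, then this path is simple
(its vertices have different colours) and so on the sphere such a region is an embedded disk. -/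
def Surrounds (w : Color → W) (D : Set (W ⊕ B)) : Prop :=
  (∀ c, Sum.inr (T.edge c (w c)) ∈ D ∧ Sum.inl (w c) ∉ D) ∧
    ∀ c u, u ≠ w c → (Sum.inl u ∈ D ↔ Sum.inr (T.edge c u) ∈ D)

variable {T} in
/-- A clockwise move leads from the state `s` to the state `t`: there are three edges, one of each
colour, that surround a disk with their white triangles on the outside, those white triangles are
matched to the three vertices on the boundary of the disk, and this matching is switched from the
clockwise one (where the white triangle at the red, green, blue edge is matched to the green, blue,
red vertex) to the counter-clockwise one (to the blue, red, green vertex). -/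
def ClockwiseMove (s t : T.State) : Prop :=
  ∃ w : Color → W, T.IsTriangle w ∧ (∃ D, T.Surrounds w D) ∧
    (∀ c, w c ∈ s.arrows c.next ∧ w c ∈ t.arrows c.prev) ∧
    ∀ u, (∀ c, u.1 ≠ w c) → t.matching u = s.matching u

end PlanarTrinity

/-!
The constituent of colour `c` and the edges of colour `c` that it does not cross form dual spanning
trees, and the tour around the constituent that starts in the outer triangle passes every end of an
arrow of `G_c^*` once. Between the two passages of an arrow the tour stays at the descendants of
that arrow in its tree. So arrows of the same tree do not cross, and an arrow outside the
constituent is matched to its vertex of colour `c.next` or `c.prev` according to whether its head or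
its tail is passed first.

The greedy search follows the tour until the tour passes the tail of an arrow `e` outside the
constituent before it moves to the head of `e` along an arrow `f` of the constituent. Such an `e` is
matched to its vertex of colour `c.prev`. Choose `e` so that its head is passed as early as
possible, and consider the ends passed after the tail of `f` and up to the head of `e`. By the
choice, only `e` has its head but not its tail among them. By counting, there is just one arrow that
has its tail but not its head among them, and it can only be matched to its vertex of colour
`c.next`. Its edge of colour `c`, the edge of colour `c.next` of `e` and the edge of colour `c.prev`
of `f` surround the disk of a clockwise move.
-/

theorem reflTransGen_iff_of_rel {α : Type*} {r : α → α → Prop} (hr : Relator.RightUnique r)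
    {x y z : α} (h : r x z) (hne : x ≠ y) :
    Relation.ReflTransGen r x y ↔ Relation.ReflTransGen r z y := by
  refine ⟨fun hxy => ?_, fun hzy => hzy.head h⟩
  obtain rfl | ⟨z', hxz', hz'y⟩ := hxy.cases_head
  · exact absurd rfl hne
  · rwa [hr h hxz']

theorem acc_flip_iff_of_rel {α : Type*} {r : α → α → Prop} (hr : Relator.RightUnique r)
    {x z : α} (h : r x z) : Acc (flip r) x ↔ Acc (flip r) z :=
  ⟨fun hx => hx.inv h, fun hz => Acc.intro x fun _ hxz' => hr h hxz' ▸ hz⟩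

theorem not_rel_self_of_acc {α : Type*} {r : α → α → Prop} {x : α} (hx : Acc r x) : ¬ r x x := by
  induction hx with
  | intro x _ ih => exact fun h => ih x h h

theorem not_reflTransGen_of_acc_flip {α : Type*} {r : α → α → Prop} {x z : α}
    (hx : Acc (flip r) x) (h : r x z) : ¬ Relation.ReflTransGen r z x := fun hzx =>
  not_rel_self_of_acc hx.transGen (Relation.transGen_swap.2 (.head' h hzx))

/-! ### Visiting times of a cyclic permutation -/

section Perm

variable {E : Type*} {σ : Equiv.Perm E}

theorem sameCycle_induction [Finite E] {x y : E} {M : E → Prop} (h : σ.SameCycle x y)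
    (hx : M x) (hσ : ∀ z, σ.SameCycle x z → M z → M (σ z)) : M y := by
  obtain ⟨n, rfl⟩ := h.exists_nat_pow_eq
  have key (n : ℕ) : M ((σ ^ n) x) := by
    induction n with
    | zero => exact hx
    | succ n ih =>
      rw [pow_succ', Equiv.Perm.mul_apply]
      exact hσ _ (Equiv.Perm.sameCycle_pow_right.2 (.refl σ x)) ih
  exact key n

/-- The number of steps that the iteration of `σ` needs to get from `x₀` to `d` for the first time
(with the junk value `0` if it never arrives there). -/
noncomputable def visitTime (σ : Equiv.Perm E) (x₀ d : E) : ℕ := sInf {k | σ^[k] x₀ = d}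

/-- The points that the iteration of `σ` from `x₀` visits after `p` and not later than `q`. -/
def arc (σ : Equiv.Perm E) (x₀ p q : E) : Set E :=
  {d | visitTime σ x₀ p < visitTime σ x₀ d ∧ visitTime σ x₀ d ≤ visitTime σ x₀ q}

variable {x₀ : E}

theorem visitTime_le {d : E} {k : ℕ} (h : σ^[k] x₀ = d) : visitTime σ x₀ d ≤ k := Nat.sInf_le h

theorem visitTime_self : visitTime σ x₀ x₀ = 0 := Nat.le_zero.1 (visitTime_le rfl)

theorem self_notMem_arc {p q : E} : x₀ ∉ arc σ x₀ p q := fun h =>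
  absurd (visitTime_self ▸ h.1) (Nat.not_lt_zero _)

variable [Finite E] (hσ : ∀ d, σ.SameCycle x₀ d)

include hσ

theorem iterate_visitTime (d : E) : σ^[visitTime σ x₀ d] x₀ = d :=
  Nat.sInf_mem (s := {k | σ^[k] x₀ = d}) (hσ d).exists_nat_pow_eq

theorem visitTime_injective : Function.Injective (visitTime σ x₀) := fun d d' h => by
  rw [← iterate_visitTime hσ d, h, iterate_visitTime hσ]

theorem visitTime_apply {d : E} (h : σ d ≠ x₀) :
    visitTime σ x₀ (σ d) = visitTime σ x₀ d + 1 := by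
  have hd := iterate_visitTime hσ (σ d)
  rcases hk : visitTime σ x₀ (σ d) with _ | k
  · rw [hk] at hd
    exact absurd hd.symm h
  · rw [hk, Function.iterate_succ_apply'] at hd
    refine le_antisymm (hk ▸ visitTime_le ?_) (Nat.succ_le_succ (visitTime_le (σ.injective hd)))
    rw [Function.iterate_succ_apply', iterate_visitTime hσ]

theorem visit_induction {P : E → Prop} (start : P x₀)
    (step : ∀ d, σ d ≠ x₀ → P d → P (σ d)) (d : E) : P d :=
  sameCycle_induction (hσ d) start fun z _ hz => by
    by_cases hx : σ z = x₀
    · rwa [hx]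
    · exact step z hx hz

theorem visitTime_le_of_apply_eq {d : E} (h : σ d = x₀) (j : E) :
    visitTime σ x₀ j ≤ visitTime σ x₀ d := by
  induction j using visit_induction hσ with
  | start => simp only [visitTime_self, Nat.zero_le]
  | step j hj ih =>
    rw [visitTime_apply hσ hj]
    refine Nat.succ_le_of_lt (ih.lt_of_ne fun hjd => hj ?_)
    rw [visitTime_injective hσ hjd, h]

theorem apply_mem_arc_iff {p q : E} (hpq : visitTime σ x₀ p < visitTime σ x₀ q) (d : E) :
    σ d ∈ arc σ x₀ p q ↔ d = p ∨ d ∈ arc σ x₀ p q ∧ d ≠ q := by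
  have hp := (visitTime_injective hσ).eq_iff (a := d) (b := p)
  have hq := (visitTime_injective hσ).eq_iff (a := d) (b := q)
  by_cases hd : σ d = x₀
  · have hlast := visitTime_le_of_apply_eq hσ hd q
    rw [hd, iff_false_left self_notMem_arc]
    simp only [arc, Set.mem_ofPred_eq, ← hp, ne_eq, ← hq]
    omega
  · simp only [arc, Set.mem_ofPred_eq, visitTime_apply hσ hd, ← hp, ne_eq, ← hq]
    omega

theorem iff_mem_arc {p q : E} {M : E → Prop} (h₀ : ¬ M x₀) (hq : M q)
    (h : ∀ d, M (σ d) ↔ d = p ∨ M d ∧ d ≠ q) (d : E) : M d ↔ d ∈ arc σ x₀ p q := by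
  have after_p (d : E) : M d → visitTime σ x₀ p < visitTime σ x₀ d := by
    induction d using visit_induction hσ with
    | start => exact fun hM => absurd hM h₀
    | step d hd ih =>
      rw [visitTime_apply hσ hd, h, Nat.lt_succ_iff]
      rintro (rfl | ⟨hM, -⟩)
      exacts [le_rfl, (ih hM).le]
  induction d using visit_induction hσ with
  | start => exact iff_of_false h₀ self_notMem_arc
  | step d _ ih => exact (h d).trans ((or_congr_right (and_congr_left' ih)).trans
      (apply_mem_arc_iff hσ (after_p q hq) d).symm)

end Perm

namespace Color

@[simp] theorem next_next (c : Color) : c.next.next = c.prev := by cases c <;> rfl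

@[simp] theorem prev_prev (c : Color) : c.prev.prev = c.next := by cases c <;> rfl

@[simp] theorem prev_next (c : Color) : c.next.prev = c := by cases c <;> rfl

@[simp] theorem next_prev (c : Color) : c.prev.next = c := by cases c <;> rfl

theorem next_ne (c : Color) : c.next ≠ c := by cases c <;> nofun

theorem prev_ne (c : Color) : c.prev ≠ c := by cases c <;> nofun

theorem next_ne_prev (c : Color) : c.next ≠ c.prev := by cases c <;> nofun

theorem eq_or_eq_next_or_eq_prev (c c' : Color) : c' = c ∨ c' = c.next ∨ c' = c.prev := by
  cases c <;> cases c' <;> simp [next, prev]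

/-- The map `Color.next`, as a permutation with inverse `Color.prev`. -/
def nextPerm : Equiv.Perm Color := ⟨next, prev, prev_next, next_prev⟩

end Color

namespace Trinity

variable {W B : Type*} (T : Trinity W B)

theorem color_eq_of_vertex_eq {c c' : Color} {w w' : W} (h : T.vertex c w = T.vertex c' w') :
    c = c' :=
  congrArg Sigma.fst h

theorem vertex_eq_iff {c : Color} {w w' : W} :
    T.vertex c w = T.vertex c w' ↔ (T.rot c).SameCycle w w' :=
  ⟨fun h => Quotient.exact (eq_of_heq (Sigma.mk.inj h).2),
    fun h => congrArg (Sigma.mk c) (Quotient.sound h)⟩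

theorem vertex_symm_edge_next (c : Color) (w : W) :
    T.vertex c ((T.edge c.next).symm (T.edge c.prev w)) = T.vertex c w :=
  T.vertex_eq_iff.2 (Equiv.Perm.sameCycle_apply_left.2 (.refl (T.rot c) w))

variable {T} in
theorem Connected.induction (hT : T.Connected) {P : W ⊕ B → Prop} {t : W ⊕ B} (ht : P t)
    (h : ∀ c w, P (Sum.inl w) ↔ P (Sum.inr (T.edge c w))) (t' : W ⊕ B) : P t' := by
  have key (x y : W ⊕ B)
      (hxy : Relation.EqvGen (fun x y => ∃ c w, x = Sum.inl w ∧ y = Sum.inr (T.edge c w)) x y) :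
      P x ↔ P y := by
    induction hxy with
    | rel x y hxy =>
      obtain ⟨c, w, rfl, rfl⟩ := hxy
      exact h c w
    | refl x => rfl
    | symm x y _ ih => exact ih.symm
    | trans x y z _ _ ih₁ ih₂ => exact ih₁.trans ih₂
  exact (key t t' (hT t t')).1 ht

/-! ### Ends of the arrows of `G_c^*` and the adjacent vertices and faces -/

@[simp] theorem opp_opp (c : Color) (d : W ⊕ B) : T.opp c (T.opp c d) = d := by
  cases d <;> simp [opp]

@[simp] theorem arrowOf_opp (c : Color) (d : W ⊕ B) : T.arrowOf c (T.opp c d) = T.arrowOf c d := by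
  cases d <;> simp [opp, arrowOf]

/-- The map `Trinity.ccw`, as a permutation. -/
def ccwPerm (c : Color) : Equiv.Perm (W ⊕ B) :=
  (Equiv.sumCongr (T.edge c.prev) (T.edge c.next).symm).trans (Equiv.sumComm B W)

theorem ccwPerm_apply (c : Color) (d : W ⊕ B) : T.ccwPerm c d = T.ccw c d := by cases d <;> rfl

/-- The vertex at an end of an arrow of `G_c^*`. -/
def endVertex (c : Color) : W ⊕ B → T.Vertex
  | Sum.inl w => T.vertex c w
  | Sum.inr b => T.vertex c ((T.edge c.prev).symm b)

/-- The vertex of another colour than `c` (and so the face of `G_c^*`) that lies between an end of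
an arrow of `G_c^*` and the clockwise preceding end about the same vertex. -/
def endFace (c : Color) : W ⊕ B → T.Vertex
  | Sum.inl w => T.vertex c.prev w
  | Sum.inr b => T.vertex c.next ((T.edge c).symm b)

theorem endVertex_ccw (c : Color) (d : W ⊕ B) :
    T.endVertex c (T.ccw c d) = T.endVertex c d := by
  rcases d with w | b
  · simp [ccw, endVertex]
  · simpa [ccw, endVertex] using T.vertex_symm_edge_next c ((T.edge c.prev).symm b)

theorem endFace_ccw (c : Color) (d : W ⊕ B) :
    T.endFace c (T.ccw c d) = T.endFace c (T.opp c d) := by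
  rcases d with w | b
  · simpa [ccw, opp, endFace] using
      (T.vertex_symm_edge_next c.next ((T.edge c).symm (T.edge c.prev w))).symm
  · simpa [ccw, opp, endFace] using
      (T.vertex_symm_edge_next c.prev ((T.edge c.next).symm b)).symm

open Classical in
/-- The vertex next to an end of an arrow of `G_c^*` in the graph `G_c^*` (if `c' = c`) or in the
dual graph, whose vertices are the vertices of the two other colours (if `c' ≠ c`). -/
noncomputable def side (c c' : Color) (d : W ⊕ B) : T.Vertex :=
  if c' = c then T.endVertex c d else T.endFace c d

theorem side_self (c : Color) (d : W ⊕ B) : T.side c c d = T.endVertex c d := if_pos rfl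

theorem side_of_ne {c c' : Color} (h : c' ≠ c) (d : W ⊕ B) : T.side c c' d = T.endFace c d :=
  if_neg h

theorem side_congr {c c₁ c₂ : Color} (h : c₁ = c ↔ c₂ = c) (d : W ⊕ B) :
    T.side c c₁ d = T.side c c₂ d := by
  classical
  exact if_congr h rfl rfl

theorem side_ccw_self (c : Color) (d : W ⊕ B) : T.side c c (T.ccw c d) = T.side c c d := by
  simp only [side_self, endVertex_ccw]

theorem side_ccw_of_ne {c c' : Color} (h : c' ≠ c) (d : W ⊕ B) :
    T.side c c' (T.ccw c d) = T.side c c' (T.opp c d) := by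
  simp only [side_of_ne _ h, endFace_ccw]

open Classical in
/-- The end of the arrow `a` of `G_c^*` that has the vertex of colour `c'` of the white triangle `a`
at its side. -/
noncomputable def endAt (c c' : Color) (a : W) : W ⊕ B :=
  if c' = c.next then Sum.inr (T.edge c a) else Sum.inl a

theorem endAt_next (c : Color) (a : W) : T.endAt c c.next a = Sum.inr (T.edge c a) := if_pos rfl

theorem endAt_of_ne {c c' : Color} (h : c' ≠ c.next) (a : W) : T.endAt c c' a = Sum.inl a :=
  if_neg h

theorem arrowOf_endAt (c c' : Color) (a : W) : T.arrowOf c (T.endAt c c' a) = a := by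
  unfold endAt
  split_ifs <;> simp [arrowOf]

theorem side_endAt (c c' : Color) (a : W) : T.side c c' (T.endAt c c' a) = T.vertex c' a := by
  obtain rfl | rfl | rfl := c.eq_or_eq_next_or_eq_prev c'
  · rw [endAt_of_ne T (Color.next_ne c').symm, side_self, endVertex]
  · rw [endAt_next, side_of_ne T (Color.next_ne c), endFace, Equiv.symm_apply_apply]
  · rw [endAt_of_ne T (Color.next_ne_prev c).symm, side_of_ne T (Color.prev_ne c), endFace]

theorem exists_side_inl_eq (c c' : Color) (w : W) :
    ∃ c₁, T.side c c' (Sum.inl w) = T.vertex c₁ w := by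
  by_cases h : c' = c
  · exact ⟨c, by rw [h, side_self, endVertex]⟩
  · exact ⟨c.prev, by rw [side_of_ne T h, endFace]⟩

theorem exists_endFace_eq (c : Color) (d : W ⊕ B) :
    ∃ c', T.endFace c d = T.vertex c' (T.arrowOf c d) := by
  cases d
  exacts [⟨c.prev, rfl⟩, ⟨c.next, rfl⟩]

theorem eq_endAt_or_opp_eq_endAt (c c' : Color) (d : W ⊕ B) :
    d = T.endAt c c' (T.arrowOf c d) ∨ T.opp c d = T.endAt c c' (T.arrowOf c d) := by
  unfold endAt
  cases d <;> split_ifs <;> simp [opp, arrowOf]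

theorem exists_insert_eq_preimage [Finite W] {c : Color} {e : W} {I : Set W} {D : Set B}
    (he : e ∉ I) (heI : insert e I = T.edge c ⁻¹' D) (hI : ∀ c, I ⊆ T.edge c ⁻¹' D) :
    ∃ w : Color → W, ∀ c, w c ∉ I ∧ insert (w c) I = T.edge c ⁻¹' D := by
  have ncard_preimage (c : Color) : (T.edge c ⁻¹' D).ncard = D.ncard :=
    Set.ncard_preimage_of_injective_subset_range (T.edge c).injective
      (by simp only [Equiv.range_eq_univ, Set.subset_univ])
  have exists_insert (c' : Color) : ∃ w ∉ I, insert w I = T.edge c' ⁻¹' D :=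
    (Set.exists_eq_insert_iff_ncard (Set.toFinite I)).2 ⟨hI c', by
      rw [← Set.ncard_insert_of_notMem he, heI, ncard_preimage, ncard_preimage]⟩
  choose w hw using exists_insert
  exact ⟨w, hw⟩

end Trinity

namespace PlanarTrinity

variable {W B : Type*} {T : PlanarTrinity W B}

theorem finite_ends (T : PlanarTrinity W B) : Finite (W ⊕ B) := by
  have := T.finite_white
  have := Finite.of_equiv W (T.edge Color.red)
  infer_instance

theorem Surrounds.isTriangle {w : Color → W} {D : Set (W ⊕ B)} (h : T.Surrounds w D) :
    T.IsTriangle w := by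
  have := T.finite_white
  obtain ⟨hw, hother⟩ := h
  intro c
  -- Turning about the vertex of `w c.prev`, one enters `D` through the edge of `w c.prev`, and one
  -- can leave it only through the edge of `w c.next`.
  have mem_of_black {u : W} (hu : Sum.inr (T.edge c.prev u) ∈ D) (hne : T.rot c u ≠ w c.next) :
      Sum.inl (T.rot c u) ∈ D := by
    refine (hother c.next _ hne).2 ?_
    rwa [show T.edge c.next (T.rot c u) = T.edge c.prev u from Equiv.apply_symm_apply _ _]
  by_contra hv
  have rot_ne {u : W} (hu : (T.rot c).SameCycle (T.rot c (w c.prev)) u) : u ≠ w c.next := by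
    rintro rfl
    exact hv (T.vertex_eq_iff.2 (Equiv.Perm.sameCycle_apply_left.1 hu).symm)
  have start : (T.rot c).SameCycle (T.rot c (w c.prev)) (w c.prev) :=
    Equiv.Perm.sameCycle_apply_left.2 (.refl _ _)
  refine (hw c.prev).2 (sameCycle_induction (M := fun u => Sum.inl u ∈ D) start
    (mem_of_black (hw c.prev).1 (rot_ne (.refl _ _))) fun u hu hmem => ?_)
  have hne : u ≠ w c.prev := fun h => (hw c.prev).2 (h ▸ hmem)
  exact mem_of_black ((hother c.prev u hne).1 hmem)
    (rot_ne (Equiv.Perm.sameCycle_apply_right.2 hu))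

theorem surrounds_of_insert_eq_preimage {w : Color → W} {I : Set W} {D : Set B}
    (h : ∀ c, w c ∉ I ∧ insert (w c) I = T.edge c ⁻¹' D) :
    T.Surrounds w (Sum.inl '' I ∪ Sum.inr '' D) := by
  have mem_iff (c : Color) (u : W) : T.edge c u ∈ D ↔ u = w c ∨ u ∈ I := by
    rw [← Set.mem_preimage, ← (h c).2, Set.mem_insert_iff]
  refine ⟨fun c => ?_, fun c u hu => ?_⟩
  · simp [mem_iff, (h c).1]
  · simp [mem_iff, hu]

namespace State

variable (s : T.State)

theorem ne_outer {c : Color} {w : W} (h : w ∈ s.arrows c) : w ≠ T.outer := h.1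

theorem vertex_ne_root {c : Color} {w : W} (h : w ∈ s.arrows c) (c' : Color) :
    T.vertex c w ≠ T.vertex c' T.outer :=
  h.2 ▸ (s.matching ⟨w, h.1⟩).2 c'

theorem exists_mem_arrows {w : W} (h : w ≠ T.outer) : ∃ c, w ∈ s.arrows c :=
  (s.incident ⟨w, h⟩).imp fun _ hc => ⟨h, hc⟩

theorem color_unique {c c' : Color} {w : W} (h : w ∈ s.arrows c) (h' : w ∈ s.arrows c') :
    c = c' :=
  T.color_eq_of_vertex_eq (h.2.symm.trans h'.2)

theorem mem_arrows_iff_eq {c c' : Color} {w : W} (h : w ∈ s.arrows c') :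
    w ∈ s.arrows c ↔ c' = c :=
  ⟨s.color_unique h, fun hc => hc ▸ h⟩

theorem exists_arrow {c : Color} {w : W} (h : T.vertex c w ≠ T.vertex c T.outer) :
    ∃ u ∈ s.arrows c, T.vertex c u = T.vertex c w := by
  have not_root (c' : Color) : T.vertex c w ≠ T.vertex c' T.outer := fun h' => by
    obtain rfl := T.color_eq_of_vertex_eq h'
    exact h h'
  obtain ⟨⟨u, hu⟩, hm⟩ := s.matching.surjective ⟨T.vertex c w, not_root⟩
  obtain ⟨c', hc'⟩ := s.incident ⟨u, hu⟩
  rw [hm] at hc'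
  obtain rfl := T.color_eq_of_vertex_eq hc'
  exact ⟨u, ⟨hu, by rw [hm, hc']⟩, hc'.symm⟩

theorem arrow_unique {c c' : Color} {w w' : W} (h : w ∈ insert T.outer (s.arrows c))
    (h' : w' ∈ insert T.outer (s.arrows c')) (hv : T.vertex c w = T.vertex c' w') : w = w' := by
  obtain rfl | h := h <;> obtain rfl | h' := h'
  · rfl
  · exact absurd hv.symm (s.vertex_ne_root h' c)
  · exact absurd hv (s.vertex_ne_root h c')
  · have := s.matching.injective (Subtype.ext (h.2.trans (hv.trans h'.2.symm)))
    exact congrArg Subtype.val this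

/-! ### The tour around a constituent -/

open Classical in
/-- The tour around the constituent of colour `c`: turn counter-clockwise about the vertices of
`G_c^*`, and at the arrows of the constituent move along them first. -/
noncomputable def tour (c : Color) : Equiv.Perm (W ⊕ B) :=
  (Function.Involutive.toPerm
    (fun d => if T.arrowOf c d ∈ s.arrows c then T.opp c d else d)
    fun d => by by_cases h : T.arrowOf c d ∈ s.arrows c <;> simp [h]).trans (T.ccwPerm c)

variable {s}

theorem tour_of_mem {c : Color} {d : W ⊕ B} (h : T.arrowOf c d ∈ s.arrows c) :
    s.tour c d = T.ccw c (T.opp c d) :=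
  (T.ccwPerm_apply c _).trans (congrArg _ (if_pos h))

theorem tour_of_notMem {c : Color} {d : W ⊕ B} (h : T.arrowOf c d ∉ s.arrows c) :
    s.tour c d = T.ccw c d :=
  (T.ccwPerm_apply c _).trans (congrArg _ (if_neg h))

theorem side_tour_of_iff {c c' : Color} {d : W ⊕ B} (h : T.arrowOf c d ∈ s.arrows c ↔ c' = c) :
    T.side c c' (s.tour c d) = T.side c c' (T.opp c d) := by
  by_cases hd : T.arrowOf c d ∈ s.arrows c
  · obtain rfl := h.1 hd
    rw [tour_of_mem hd, T.side_ccw_self]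
  · rw [tour_of_notMem hd, T.side_ccw_of_ne (mt h.2 hd)]

theorem side_tour_of_not_iff {c c' : Color} {d : W ⊕ B}
    (h : ¬ (T.arrowOf c d ∈ s.arrows c ↔ c' = c)) :
    T.side c c' (s.tour c d) = T.side c c' d := by
  by_cases hd : T.arrowOf c d ∈ s.arrows c
  · rw [tour_of_mem hd, T.side_ccw_of_ne (by tauto), T.opp_opp]
  · obtain rfl : c' = c := by tauto
    rw [tour_of_notMem hd, T.side_ccw_self]

variable (s) in
/-- `s.Parent c x z`: the arrow matched to `x` joins `x` to `z`, in the constituent of colour `c`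
(if `x` has colour `c`) or in the dual tree, which is formed by the edges of colour `c` that the
constituent does not cross (otherwise). -/
def Parent (c : Color) (x z : T.Vertex) : Prop :=
  ∃ c', ∃ a ∈ s.arrows c', x = T.vertex c' a ∧ z = T.side c c' (T.opp c (T.endAt c c' a))

variable (s) in
/-- `s.Desc c y x`: the vertex `x` is a descendant of `y` (possibly `y` itself) in the constituent
of colour `c` or in its dual tree. -/
def Desc (c : Color) (y x : T.Vertex) : Prop := Relation.ReflTransGen (s.Parent c) x y

variable (s) in
/-- The iterated parents of `x` end at a root. -/
def Rooted (c : Color) (x : T.Vertex) : Prop := Acc (flip (s.Parent c)) x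

theorem parent_rightUnique (c : Color) : Relator.RightUnique (s.Parent c) := by
  rintro x z z' ⟨c₁, a, ha, hx, rfl⟩ ⟨c₂, b, hb, hx', rfl⟩
  obtain rfl := T.color_eq_of_vertex_eq (hx.symm.trans hx')
  rw [s.arrow_unique (.inr ha) (.inr hb) (hx.symm.trans hx')]

theorem not_parent_root {c c' : Color} {z : T.Vertex} :
    ¬ s.Parent c (T.vertex c' T.outer) z := by
  rintro ⟨_, a, ha, h, -⟩
  exact s.vertex_ne_root ha _ h.symm

theorem desc_root {c c' : Color} {y : T.Vertex} (h : s.Desc c y (T.vertex c' T.outer)) :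
    y = T.vertex c' T.outer := by
  obtain h | ⟨_, h, -⟩ := h.cases_head
  · exact h.symm
  · exact absurd h not_parent_root

theorem rooted_root (c c' : Color) : s.Rooted c (T.vertex c' T.outer) :=
  .intro _ fun _ h => absurd h not_parent_root

/-- The two sides of an arrow are a vertex and its parent, or two roots. -/
theorem side_opp_iff {c c' : Color} {d : W ⊕ B} {P : T.Vertex → Prop}
    (hd : T.arrowOf c d ∈ s.arrows c ↔ c' = c)
    (hroot : T.arrowOf c d = T.outer → ∀ c₁ c₂, P (T.vertex c₁ T.outer) → P (T.vertex c₂ T.outer))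
    (hparent : ∀ c₁, T.arrowOf c d ∈ s.arrows c₁ → ∀ z,
      s.Parent c (T.vertex c₁ (T.arrowOf c d)) z → (P (T.vertex c₁ (T.arrowOf c d)) ↔ P z)) :
    P (T.side c c' (T.opp c d)) ↔ P (T.side c c' d) := by
  by_cases ho : T.arrowOf c d = T.outer
  · have hc' : c' ≠ c := fun h => s.ne_outer (hd.2 h) ho
    obtain ⟨c₁, h₁⟩ := T.exists_endFace_eq c d
    obtain ⟨c₂, h₂⟩ := T.exists_endFace_eq c (T.opp c d)
    rw [T.side_of_ne hc', T.side_of_ne hc', h₁, h₂, T.arrowOf_opp, ho]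
    exact ⟨hroot ho _ _, hroot ho _ _⟩
  · obtain ⟨c₁, ha⟩ := s.exists_mem_arrows ho
    have hc₁ : c' = c ↔ c₁ = c := hd.symm.trans (s.mem_arrows_iff_eq ha)
    rw [T.side_congr hc₁, T.side_congr hc₁]
    have key := hparent c₁ ha _ ⟨c₁, _, ha, rfl, rfl⟩
    rw [← T.side_endAt c] at key
    obtain h | h := T.eq_endAt_or_opp_eq_endAt c c₁ d <;> rw [← h] at key
    · exact key.symm
    · rwa [T.opp_opp] at key

theorem rooted_side_opp_iff {c c' : Color} {d : W ⊕ B}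
    (hd : T.arrowOf c d ∈ s.arrows c ↔ c' = c) :
    s.Rooted c (T.side c c' (T.opp c d)) ↔ s.Rooted c (T.side c c' d) :=
  side_opp_iff hd (fun _ _ _ _ => rooted_root c _)
    fun _ _ _ h => acc_flip_iff_of_rel (parent_rightUnique c) h

theorem rooted_side_tour {c c' : Color} {d : W ⊕ B} (h : s.Rooted c (T.side c c' d)) :
    s.Rooted c (T.side c c' (s.tour c d)) := by
  by_cases hd : T.arrowOf c d ∈ s.arrows c ↔ c' = c
  · rwa [side_tour_of_iff hd, rooted_side_opp_iff hd]
  · rwa [side_tour_of_not_iff hd]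

theorem desc_side_opp_iff {c c' c₁ : Color} {a : W} {d : W ⊕ B}
    (ha : a ∈ insert T.outer (s.arrows c')) (hne : T.arrowOf c d ≠ a)
    (hd : T.arrowOf c d ∈ s.arrows c ↔ c₁ = c) :
    s.Desc c (T.vertex c' a) (T.side c c₁ (T.opp c d)) ↔
      s.Desc c (T.vertex c' a) (T.side c c₁ d) := by
  refine side_opp_iff hd (fun ho _ _ h => ?_) fun _ hmem z hz =>
    reflTransGen_iff_of_rel (parent_rightUnique c) hz fun hv =>
      hne (s.arrow_unique (.inr hmem) ha hv)
  exact absurd (s.arrow_unique ha (.inl rfl) (desc_root h)) (ho ▸ hne.symm)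

theorem desc_side_tour_iff {c c' : Color} {a : W} {d : W ⊕ B}
    (ha : a ∈ insert T.outer (s.arrows c')) (hne : T.arrowOf c d ≠ a) (c₁ : Color) :
    s.Desc c (T.vertex c' a) (T.side c c₁ (s.tour c d)) ↔
      s.Desc c (T.vertex c' a) (T.side c c₁ d) := by
  by_cases hd : T.arrowOf c d ∈ s.arrows c ↔ c₁ = c
  · rw [side_tour_of_iff hd, desc_side_opp_iff ha hne hd]
  · rw [side_tour_of_not_iff hd]

theorem not_desc_side_opp_endAt {c c' : Color} {a : W} (ha : a ∈ s.arrows c')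
    (hr : s.Rooted c (T.vertex c' a)) :
    ¬ s.Desc c (T.vertex c' a) (T.side c c' (T.opp c (T.endAt c c' a))) :=
  not_reflTransGen_of_acc_flip hr ⟨c', a, ha, rfl, rfl⟩

/-- A passage of the tour along or across an arrow is paired with the opposite passage, because
only these two passages enter and leave the descendants of the vertex of the arrow. -/
theorem sameCycle_endAt_opp {c c' : Color} {a : W} (ha : a ∈ insert T.outer (s.arrows c'))
    (hc : a ∈ s.arrows c ↔ c' = c)
    (hentry : ¬ s.Desc c (T.vertex c' a) (T.side c c' (T.opp c (T.endAt c c' a)))) :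
    (s.tour c).SameCycle (T.endAt c c' a) (T.opp c (T.endAt c c' a)) := by
  have := T.finite_ends
  set q := T.endAt c c' a with hq
  have hqa : T.arrowOf c q = a := T.arrowOf_endAt c c' a
  have hqv : T.side c c' q = T.vertex c' a := T.side_endAt c c' a
  set p := T.opp c q with hp
  have hpa : T.arrowOf c p = a := by rw [hp, T.arrowOf_opp, hqa]
  by_contra hpq
  refine hentry (sameCycle_induction (x := s.tour c p) (y := p)
    (M := fun d => s.Desc c (T.vertex c' a) (T.side c c' d))
    (Equiv.Perm.sameCycle_apply_left.2 (.refl _ _)) ?_ fun d hd hM => ?_)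
  · rw [side_tour_of_iff (hpa ▸ hc), hp, T.opp_opp, hqv]
    exact .refl
  · have hne : T.arrowOf c d ≠ a := fun hda => by
      obtain h | h := T.eq_endAt_or_opp_eq_endAt c c' d <;> rw [hda, ← hq] at h
      · exact hpq (h ▸ (Equiv.Perm.sameCycle_apply_left.1 hd).symm)
      · rw [hp, ← h, T.opp_opp] at hentry
        exact hentry hM
    exact (desc_side_tour_iff ha hne c').2 hM

theorem rooted_of_sameCycle {c : Color} {d : W ⊕ B}
    (h : (s.tour c).SameCycle (Sum.inl T.outer) d) (c' : Color) : s.Rooted c (T.side c c' d) := by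
  have := T.finite_ends
  obtain ⟨c₁, h₁⟩ := T.exists_side_inl_eq c c' T.outer
  exact sameCycle_induction (M := fun d => s.Rooted c (T.side c c' d)) h
    (h₁ ▸ rooted_root c c₁) fun _ _ => rooted_side_tour

theorem sameCycle_opp {c : Color} {d : W ⊕ B} (h : (s.tour c).SameCycle (Sum.inl T.outer) d) :
    (s.tour c).SameCycle (Sum.inl T.outer) (T.opp c d) := by
  suffices hd : ∃ c', (s.tour c).SameCycle (T.endAt c c' (T.arrowOf c d))
      (T.opp c (T.endAt c c' (T.arrowOf c d))) by
    obtain ⟨c', hc'⟩ := hd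
    obtain hd | hd := T.eq_endAt_or_opp_eq_endAt c c' d <;> rw [← hd] at hc'
    · exact h.trans hc'
    · rw [T.opp_opp] at hc'
      exact h.trans hc'.symm
  by_cases ho : T.arrowOf c d = T.outer
  · refine ⟨c.next, sameCycle_endAt_opp (.inl ho) ?_ fun hdesc => ?_⟩
    · exact iff_of_false (fun hmem => s.ne_outer hmem ho) (Color.next_ne c)
    · have hprev : T.side c c.next (T.opp c (T.endAt c c.next T.outer)) =
          T.vertex c.prev T.outer := by
        simp [T.endAt_next, T.side_of_ne (Color.next_ne c), Trinity.opp, Trinity.endFace]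
      rw [ho, hprev] at hdesc
      exact Color.next_ne_prev c (T.color_eq_of_vertex_eq (desc_root hdesc))
  · obtain ⟨c', ha⟩ := s.exists_mem_arrows ho
    have hc := s.mem_arrows_iff_eq ha (c := c)
    refine ⟨c', sameCycle_endAt_opp (.inr ha) hc (not_desc_side_opp_endAt ha ?_)⟩
    rw [← T.side_endAt c]
    obtain hd | hd := T.eq_endAt_or_opp_eq_endAt c c' d <;> rw [← hd]
    · exact rooted_of_sameCycle h c'
    · exact (rooted_side_opp_iff hc).2 (rooted_of_sameCycle h c')

theorem sameCycle_ccw_iff {c : Color} {d : W ⊕ B} :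
    (s.tour c).SameCycle (Sum.inl T.outer) (T.ccw c d) ↔
      (s.tour c).SameCycle (Sum.inl T.outer) d := by
  have := T.finite_ends
  have ccw_closed (d : W ⊕ B) (h : (s.tour c).SameCycle (Sum.inl T.outer) d) :
      (s.tour c).SameCycle (Sum.inl T.outer) (T.ccwPerm c d) := by
    rw [T.ccwPerm_apply]
    by_cases hd : T.arrowOf c d ∈ s.arrows c
    · have := Equiv.Perm.sameCycle_apply_right.2 (sameCycle_opp h)
      rwa [tour_of_mem (by rwa [T.arrowOf_opp]), T.opp_opp] at this
    · exact tour_of_notMem hd ▸ Equiv.Perm.sameCycle_apply_right.2 h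
  rw [← T.ccwPerm_apply]
  exact ⟨fun h => sameCycle_induction (Equiv.Perm.sameCycle_apply_left.2 (.refl _ _)) h
    fun d _ => ccw_closed d, ccw_closed d⟩

variable (s) in
theorem sameCycle_tour (c : Color) (d : W ⊕ B) :
    (s.tour c).SameCycle (Sum.inl T.outer) d := by
  refine T.connected.induction (.refl _ _) (fun c' w => ?_) d
  obtain rfl | rfl | rfl := c.eq_or_eq_next_or_eq_prev c'
  · exact ⟨sameCycle_opp, fun h => by simpa [Trinity.opp] using sameCycle_opp h⟩
  · have : T.ccw c (Sum.inr (T.edge c.next w)) = Sum.inl w := by simp [Trinity.ccw]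
    rw [← this, sameCycle_ccw_iff]
  · exact sameCycle_ccw_iff.symm

variable (s) in
/-- The time at which the tour that starts in the outer triangle passes an end. -/
noncomputable abbrev time (c : Color) (d : W ⊕ B) : ℕ := visitTime (s.tour c) (Sum.inl T.outer) d

variable (s) in
/-- The ends that the tour passes after `p` and not later than `q`. -/
abbrev tourArc (c : Color) (p q : W ⊕ B) : Set (W ⊕ B) := arc (s.tour c) (Sum.inl T.outer) p q

theorem mem_tourArc_iff {c : Color} {p q d : W ⊕ B} :
    d ∈ s.tourArc c p q ↔ s.time c p < s.time c d ∧ s.time c d ≤ s.time c q :=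
  Iff.rfl

variable (s) in
theorem time_eq_iff (c : Color) {d d' : W ⊕ B} : s.time c d = s.time c d' ↔ d = d' :=
  have := T.finite_ends
  (visitTime_injective (s.sameCycle_tour c)).eq_iff

theorem desc_iff_mem_tourArc {c c' : Color} {a : W} (ha : a ∈ s.arrows c') (d : W ⊕ B) :
    s.Desc c (T.vertex c' a) (T.side c c' d) ↔
      d ∈ s.tourArc c (T.opp c (T.endAt c c' a)) (T.endAt c c' a) := by
  have := T.finite_ends
  set q := T.endAt c c' a with hq
  have hqa : T.arrowOf c q = a := T.arrowOf_endAt c c' a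
  have hqv : T.side c c' q = T.vertex c' a := T.side_endAt c c' a
  have hc : a ∈ s.arrows c ↔ c' = c := s.mem_arrows_iff_eq ha
  have hentry : ¬ s.Desc c (T.vertex c' a) (T.side c c' (T.opp c q)) :=
    not_desc_side_opp_endAt ha (hqv ▸ rooted_of_sameCycle (s.sameCycle_tour c q) c')
  have hself : s.Desc c (T.vertex c' a) (T.side c c' q) := hqv ▸ .refl
  have hqp : q ≠ T.opp c q := fun h => hentry (h ▸ hself)
  have not_desc_start : ¬ s.Desc c (T.vertex c' a) (T.side c c' (Sum.inl T.outer)) := by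
    obtain ⟨c₁, h₁⟩ := T.exists_side_inl_eq c c' T.outer
    exact fun h => s.vertex_ne_root ha c₁ (desc_root (h₁ ▸ h))
  refine iff_mem_arc (M := fun d => s.Desc c (T.vertex c' a) (T.side c c' d))
    (s.sameCycle_tour c) not_desc_start hself (fun d => ?_) d
  by_cases hd : T.arrowOf c d = a
  · rw [side_tour_of_iff (hd ▸ hc)]
    obtain h | h := T.eq_endAt_or_opp_eq_endAt c c' d <;> rw [hd, ← hq] at h
    · rw [h, iff_false_left hentry]
      simpa using hqp
    · obtain rfl : d = T.opp c q := by rw [← h, T.opp_opp]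
      rw [T.opp_opp]
      exact iff_of_true hself (.inl rfl)
  · have hdq : d ≠ q := fun h => hd (h ▸ hqa)
    have hdp : d ≠ T.opp c q := fun h => hd (by rw [h, T.arrowOf_opp, hqa])
    rw [desc_side_tour_iff (.inr ha) hd]
    exact ⟨fun h => .inr ⟨h, hdq⟩, fun h => (h.resolve_left hdp).1⟩

theorem time_opp_endAt_lt {c c' : Color} {a : W} (ha : a ∈ s.arrows c') :
    s.time c (T.opp c (T.endAt c c' a)) < s.time c (T.endAt c c' a) :=
  ((desc_iff_mem_tourArc ha _).1 (T.side_endAt c c' a ▸ .refl)).1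

theorem time_tail_lt_head {c c' : Color} {a : W} (ha : a ∈ s.arrows c') (hc : c' ≠ c.next) :
    s.time c (Sum.inr (T.edge c a)) < s.time c (Sum.inl a) := by
  simpa only [T.endAt_of_ne hc, Trinity.opp] using time_opp_endAt_lt (c := c) ha

theorem time_head_lt_tail {c : Color} {a : W} (ha : a ∈ s.arrows c.next) :
    s.time c (Sum.inl a) < s.time c (Sum.inr (T.edge c a)) := by
  simpa only [T.endAt_next, Trinity.opp, Equiv.symm_apply_apply] using
    time_opp_endAt_lt (c := c) ha

/-- Two arrows that are both in the constituent, or both in the dual tree, do not cross. -/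
theorem tail_mem_tourArc_iff {c c' : Color} {a b : W} (ha : a ∈ s.arrows c') (hc : c' ≠ c.next)
    (hb : b ∈ s.arrows c ↔ c' = c) (hne : b ≠ a) :
    Sum.inr (T.edge c b) ∈ s.tourArc c (Sum.inr (T.edge c a)) (Sum.inl a) ↔
      Sum.inl b ∈ s.tourArc c (Sum.inr (T.edge c a)) (Sum.inl a) := by
  have key := desc_side_opp_iff (d := Sum.inl b) (.inr ha) hne hb
  simpa only [desc_iff_mem_tourArc ha, T.endAt_of_ne hc, Trinity.opp] using key

theorem head_mem_tourArc_iff {c : Color} {a b : W} (ha : a ∈ s.arrows c) :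
    Sum.inl b ∈ s.tourArc c (Sum.inr (T.edge c a)) (Sum.inl a) ↔
      s.Desc c (T.vertex c a) (T.vertex c b) := by
  have key := desc_iff_mem_tourArc (c := c) ha (Sum.inl b)
  rw [T.endAt_of_ne (Color.next_ne c).symm, T.side_self] at key
  exact key.symm

theorem time_tail_le_of_desc {c : Color} {f g : W} (hf : f ∈ s.arrows c) (hg : g ∈ s.arrows c)
    (h : s.Desc c (T.vertex c f) (T.vertex c g)) :
    s.time c (Sum.inr (T.edge c f)) ≤ s.time c (Sum.inr (T.edge c g)) := by
  by_cases hgf : g = f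
  · rw [hgf]
  · exact ((tail_mem_tourArc_iff hf (Color.next_ne c).symm (iff_of_true hg rfl) hgf).2
      ((head_mem_tourArc_iff hf).2 h)).1.le

/-! ### Deviations from the greedy search -/

variable (s) in
/-- The arrow `e` is not in the constituent of colour `c`, but the tour passes its tail before it
moves to the head of `e` along the arrow `f` of the constituent. So a greedy search that has
followed the tour up to this tail departs from it there. -/
structure Deviates (c : Color) (e f : W) : Prop where
  notMem : e ∉ s.arrows c
  mem : f ∈ s.arrows c
  vertex_eq : T.vertex c e = T.vertex c f
  tail_lt_tail : s.time c (Sum.inr (T.edge c e)) < s.time c (Sum.inr (T.edge c f))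

variable (s) in
/-- The arrows that the greedy search has selected after `k` steps if it follows the tour: those
arrows of the constituent of colour `c` whose tails the tour has passed before time `k`. -/
def visited (c : Color) (k : ℕ) : Set W :=
  {a ∈ s.arrows c | s.time c (Sum.inr (T.edge c a)) < k}

theorem visited_union_selected {c : Color} (h : ∀ e f, ¬ s.Deviates c e f) (k : ℕ) :
    s.visited c k ∪ T.selected c ((s.tour c)^[k] (Sum.inl T.outer)) (s.visited c k) =
      s.visited c (k + 1) := by
  have := T.finite_ends
  ext a
  constructor
  · rintro (⟨ha, hlt⟩ | ⟨htail, hroot, hnew⟩)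
    · exact ⟨ha, hlt.trans (Nat.lt_succ_self k)⟩
    have hle : s.time c (Sum.inr (T.edge c a)) ≤ k := visitTime_le htail
    refine ⟨by_contra fun ha => ?_, Nat.lt_succ_of_le hle⟩
    obtain ⟨f, hf, hv⟩ := s.exists_arrow hroot
    refine hnew f ⟨hf, lt_of_lt_of_le (lt_of_le_of_ne ?_ fun heq => ?_) hle⟩ hv.symm
    · exact not_lt.1 fun hlt => h a f ⟨ha, hf, hv.symm, hlt⟩
    · rw [time_eq_iff, Sum.inr.injEq, EmbeddingLike.apply_eq_iff_eq] at heq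
      exact ha (heq ▸ hf)
  · rintro ⟨ha, hlt⟩
    by_cases hk : a ∈ s.visited c k
    · exact .inl hk
    refine .inr ⟨?_, s.vertex_ne_root ha c, fun u hu hv => hk ?_⟩
    · have htime : s.time c (Sum.inr (T.edge c a)) = k :=
        (Nat.le_of_lt_succ hlt).antisymm (not_lt.1 fun hlt => hk ⟨ha, hlt⟩)
      rw [← htime]
      exact iterate_visitTime (s.sameCycle_tour c) _
    · exact s.arrow_unique (.inr ha) (.inr hu.1) hv ▸ hu

theorem arrowOf_iterate_mem_visited_iff (c : Color) (k : ℕ) :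
    T.arrowOf c ((s.tour c)^[k] (Sum.inl T.outer)) ∈ s.visited c (k + 1) ↔
      T.arrowOf c ((s.tour c)^[k] (Sum.inl T.outer)) ∈ s.arrows c := by
  refine ⟨And.left, fun ha => ⟨ha, Nat.lt_succ_of_le ?_⟩⟩
  have hle : s.time c ((s.tour c)^[k] (Sum.inl T.outer)) ≤ k := visitTime_le rfl
  generalize (s.tour c)^[k] (Sum.inl T.outer) = d at ha hle
  rcases d with w | b
  · exact (time_tail_lt_head ha (Color.next_ne c).symm).le.trans hle
  · simpa only [Trinity.arrowOf, Equiv.apply_symm_apply] using hle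

theorem greedyStep_iterate {c : Color} (h : ∀ e f, ¬ s.Deviates c e f) (k : ℕ) :
    (T.greedyStep c)^[k] (Sum.inl T.outer, ∅) =
      ((s.tour c)^[k] (Sum.inl T.outer), s.visited c k) := by
  induction k with
  | zero => simp [visited]
  | succ k ih =>
    rw [Function.iterate_succ_apply', Function.iterate_succ_apply', ih]
    refine Prod.ext ?_ (visited_union_selected h k)
    simp only [greedyStep]
    split_ifs with ha <;>
      rw [visited_union_selected h, arrowOf_iterate_mem_visited_iff] at ha
    · rw [tour_of_mem ha]
    · rw [tour_of_notMem ha]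

theorem arrows_eq_clocked {c : Color} (h : ∀ e f, ¬ s.Deviates c e f) :
    s.arrows c = T.clocked c := by
  ext a
  simp only [clocked, greedyStep_iterate h, Set.mem_ofPred_eq]
  exact ⟨fun ha => ⟨_, ha, Nat.lt_succ_self _⟩, fun ⟨_, ha⟩ => ha.1⟩

namespace Deviates

variable {c : Color} {e f : W}

theorem tail_lt_head (h : s.Deviates c e f) :
    s.time c (Sum.inr (T.edge c f)) < s.time c (Sum.inl e) :=
  ((head_mem_tourArc_iff h.mem).2 (h.vertex_eq ▸ .refl)).1

theorem head_lt_head (h : s.Deviates c e f) :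
    s.time c (Sum.inl e) < s.time c (Sum.inl f) := by
  refine ((head_mem_tourArc_iff h.mem).2 (h.vertex_eq ▸ .refl)).2.lt_of_ne fun hef => h.notMem ?_
  obtain rfl : e = f := Sum.inl_injective ((s.time_eq_iff c).1 hef)
  exact h.mem

theorem mem_prev (h : s.Deviates c e f) : e ∈ s.arrows c.prev := by
  have e_ne_outer : e ≠ T.outer := fun he => s.vertex_ne_root h.mem c (he ▸ h.vertex_eq).symm
  obtain ⟨c', he⟩ := s.exists_mem_arrows e_ne_outer
  obtain rfl | rfl | rfl := c.eq_or_eq_next_or_eq_prev c'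
  · exact absurd he h.notMem
  · exact absurd (time_head_lt_tail he) (h.tail_lt_tail.trans h.tail_lt_head).not_gt
  · exact he

end Deviates

theorem exists_deviates_minimal {c : Color} (hc : s.arrows c ≠ T.clocked c) :
    ∃ e f, s.Deviates c e f ∧
      ∀ a g, s.Deviates c a g → s.time c (Sum.inl e) ≤ s.time c (Sum.inl a) := by
  have hex : ∃ e, ∃ f, s.Deviates c e f := by
    by_contra! hno
    exact hc (arrows_eq_clocked hno)
  obtain ⟨e, ⟨f, hef⟩, hmin⟩ :=
    exists_minimalFor_of_wellFoundedLT (fun e => ∃ f, s.Deviates c e f)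
      (fun e => s.time c (Sum.inl e)) hex
  exact ⟨e, f, hef, fun a g hag => (le_total _ _).elim id (hmin ⟨g, hag⟩)⟩

variable (s) in
/-- The ends that the tour passes after it has moved along the arrow `f` and not later than the
head of the arrow `e`. If `e` deviates and `f` is the arrow of the constituent with the same head,
these are the ends in the sector from `f` to `e` at that head and in the branches of the constituent
that grow in this sector. -/
abbrev cutOff (c : Color) (e f : W) : Set (W ⊕ B) :=
  s.tourArc c (Sum.inr (T.edge c f)) (Sum.inl e)

namespace Deviates

variable {c : Color} {e f : W}

theorem head_mem_cutOff (h : s.Deviates c e f) : Sum.inl e ∈ s.cutOff c e f :=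
  ⟨h.tail_lt_head, le_rfl⟩

theorem tail_notMem_cutOff (h : s.Deviates c e f) : Sum.inr (T.edge c e) ∉ s.cutOff c e f :=
  fun hR => hR.1.not_gt h.tail_lt_tail

theorem tour_mem_cutOff_iff (h : s.Deviates c e f) (d : W ⊕ B) :
    s.tour c d ∈ s.cutOff c e f ↔
      d = Sum.inr (T.edge c f) ∨ d ∈ s.cutOff c e f ∧ d ≠ Sum.inl e :=
  have := T.finite_ends
  apply_mem_arc_iff (s.sameCycle_tour c) h.tail_lt_head d

theorem tail_mem_cutOff_iff_of_mem (h : s.Deviates c e f) {a : W} (ha : a ∈ s.arrows c) :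
    Sum.inr (T.edge c a) ∈ s.cutOff c e f ↔ Sum.inl a ∈ s.cutOff c e f := by
  have hhead_f := h.head_lt_head
  by_cases haf : a = f
  · subst haf
    exact iff_of_false (fun hR => hR.1.false) fun hR => hR.2.not_gt hhead_f
  have htail_f := h.tail_lt_head
  have head_ne_head : s.time c (Sum.inl a) ≠ s.time c (Sum.inl e) := fun heq =>
    h.notMem (Sum.inl_injective ((s.time_eq_iff c).1 heq) ▸ ha)
  have tail_ne_tail : s.time c (Sum.inr (T.edge c a)) ≠ s.time c (Sum.inr (T.edge c f)) := by
    simpa [time_eq_iff] using haf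
  have tail_ne_head : s.time c (Sum.inr (T.edge c a)) ≠ s.time c (Sum.inl e) := by
    simp [time_eq_iff]
  have head_ne_tail : s.time c (Sum.inl a) ≠ s.time c (Sum.inr (T.edge c f)) := by
    simp [time_eq_iff]
  have ha_lt := time_tail_lt_head ha (Color.next_ne c).symm
  -- The heads of `e` and `f` are at the same vertex, and `a` does not cross `f`. So `a` encloses
  -- the head of `e` if and only if it encloses the tail of `f`.
  have key := (tail_mem_tourArc_iff ha (Color.next_ne c).symm (iff_of_true h.mem rfl)
    (Ne.symm haf)).trans (head_mem_tourArc_iff ha)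
  rw [← h.vertex_eq, ← head_mem_tourArc_iff ha] at key
  simp only [cutOff, mem_tourArc_iff] at key ⊢
  omega

theorem ccw_mem_cutOff_iff (h : s.Deviates c e f) (d : W ⊕ B) :
    T.ccw c d ∈ s.cutOff c e f ↔ d = Sum.inl f ∨ d ∈ s.cutOff c e f ∧ d ≠ Sum.inl e := by
  by_cases hd : T.arrowOf c d ∈ s.arrows c
  · have hopp : T.opp c d ∈ s.cutOff c e f ↔ d ∈ s.cutOff c e f := by
      have := h.tail_mem_cutOff_iff_of_mem hd
      rcases d with w | b
      · exact this
      · simpa [Trinity.arrowOf, Trinity.opp] using this.symm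
    have hf : T.opp c d = Sum.inr (T.edge c f) ↔ d = Sum.inl f := by
      cases d <;> simp [Trinity.opp]
    have he {d' : W ⊕ B} (hd' : T.arrowOf c d' ∈ s.arrows c) : d' ≠ Sum.inl e := by
      rintro rfl
      exact h.notMem hd'
    have htour : s.tour c (T.opp c d) = T.ccw c d := by
      rw [tour_of_mem (by rwa [T.arrowOf_opp]), T.opp_opp]
    rw [← htour, h.tour_mem_cutOff_iff, hf, hopp, and_iff_left (he hd),
      and_iff_left (he (by rwa [T.arrowOf_opp]))]
  · have hhead : d ≠ Sum.inl f := by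
      rintro rfl
      exact hd h.mem
    have htail : d ≠ Sum.inr (T.edge c f) := by
      rintro rfl
      exact hd (by simpa [Trinity.arrowOf] using h.mem)
    rw [← tour_of_notMem hd, h.tour_mem_cutOff_iff, or_iff_right htail, or_iff_right hhead]

theorem deviates_of_head_mem_cutOff (h : s.Deviates c e f) {a : W} (ha : a ∉ s.arrows c)
    (hne : a ≠ e) (hhead : Sum.inl a ∈ s.cutOff c e f)
    (htail : Sum.inr (T.edge c a) ∉ s.cutOff c e f) : ∃ g, s.Deviates c a g := by
  have hdesc : s.Desc c (T.vertex c f) (T.vertex c a) :=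
    (head_mem_tourArc_iff h.mem).1 ⟨hhead.1, hhead.2.trans h.head_lt_head.le⟩
  have a_ne_root : T.vertex c a ≠ T.vertex c T.outer := fun hr =>
    s.vertex_ne_root h.mem c (desc_root (hr ▸ hdesc))
  obtain ⟨g, hg, hv⟩ := s.exists_arrow a_ne_root
  have htail_e : Sum.inr (T.edge c a) ∈ s.tourArc c (Sum.inr (T.edge c e)) (Sum.inl e) :=
    (tail_mem_tourArc_iff h.mem_prev (Color.next_ne_prev c).symm
      (iff_of_false ha (Color.prev_ne c)) hne).2 ⟨h.tail_lt_tail.trans hhead.1, hhead.2⟩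
  have htail_f : s.time c (Sum.inr (T.edge c a)) < s.time c (Sum.inr (T.edge c f)) := by
    refine lt_of_le_of_ne (not_lt.1 fun hlt => htail ⟨hlt, htail_e.2⟩) fun heq => ha ?_
    rw [time_eq_iff, Sum.inr.injEq, EmbeddingLike.apply_eq_iff_eq] at heq
    exact heq ▸ h.mem
  exact ⟨g, ha, hg, hv.symm, htail_f.trans_le (time_tail_le_of_desc h.mem hg (hv ▸ hdesc))⟩

theorem tail_mem_cutOff (h : s.Deviates c e f)
    (hmin : ∀ a g, s.Deviates c a g → s.time c (Sum.inl e) ≤ s.time c (Sum.inl a)) {a : W}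
    (hne : a ≠ e) (ha : Sum.inl a ∈ s.cutOff c e f) :
    Sum.inr (T.edge c a) ∈ s.cutOff c e f := by
  by_cases hA : a ∈ s.arrows c
  · exact (h.tail_mem_cutOff_iff_of_mem hA).2 ha
  · by_contra htail
    obtain ⟨g, hg⟩ := h.deviates_of_head_mem_cutOff hA hne ha htail
    exact hne (Sum.inl_injective ((s.time_eq_iff c).1 (ha.2.antisymm (hmin a g hg))))

theorem mem_next_of_tail_mem_cutOff (h : s.Deviates c e f) {a : W}
    (htail : Sum.inr (T.edge c a) ∈ s.cutOff c e f) (hhead : Sum.inl a ∉ s.cutOff c e f) :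
    a ∈ s.arrows c.next := by
  have ha : a ∉ s.arrows c := fun ha => hhead ((h.tail_mem_cutOff_iff_of_mem ha).1 htail)
  have hne : a ≠ e := fun hae => hhead (hae ▸ h.head_mem_cutOff)
  have hhead_e : Sum.inl a ∈ s.tourArc c (Sum.inr (T.edge c e)) (Sum.inl e) :=
    (tail_mem_tourArc_iff h.mem_prev (Color.next_ne_prev c).symm
      (iff_of_false ha (Color.prev_ne c)) hne).1 ⟨h.tail_lt_tail.trans htail.1, htail.2⟩
  have a_ne_outer : a ≠ T.outer := fun ho => self_notMem_arc (ho ▸ hhead_e)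
  obtain ⟨c', hc'⟩ := s.exists_mem_arrows a_ne_outer
  obtain rfl | rfl | rfl := c.eq_or_eq_next_or_eq_prev c'
  · exact absurd hc' ha
  · exact hc'
  · refine absurd ⟨htail.1.trans ?_, hhead_e.2⟩ hhead
    exact time_tail_lt_head hc' (Color.next_ne_prev c).symm

end Deviates

theorem Deviates.exists_surrounds {c : Color} {e f : W} (h : s.Deviates c e f)
    (hmin : ∀ a g, s.Deviates c a g → s.time c (Sum.inl e) ≤ s.time c (Sum.inl a)) :
    ∃ w D, T.Surrounds w D ∧ ∀ c', w c' ∈ s.arrows c'.next := by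
  have := T.finite_white
  let I : Set W := {u | Sum.inl u ∈ s.cutOff c e f ∧ u ≠ e}
  let D : Set B := {b | Sum.inr b ∈ s.cutOff c e f}
  have he : e ∉ I := fun h => h.2 rfl
  have hf : f ∉ I := fun hf => hf.1.2.not_gt h.head_lt_head
  have hnext : insert e I = T.edge c.next ⁻¹' D := by
    ext u
    have := h.ccw_mem_cutOff_iff (Sum.inr (T.edge c.next u))
    simp only [Trinity.ccw, Equiv.symm_apply_apply] at this
    by_cases hu : u = e <;> simp_all [I, D, h.head_mem_cutOff]
  have hprev : insert f I = T.edge c.prev ⁻¹' D := by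
    ext u
    simpa [I, D, Trinity.ccw] using (h.ccw_mem_cutOff_iff (Sum.inl u)).symm
  have hI (c' : Color) : I ⊆ T.edge c' ⁻¹' D := by
    obtain rfl | rfl | rfl := c.eq_or_eq_next_or_eq_prev c'
    · exact fun u hu => h.tail_mem_cutOff hmin hu.2 hu.1
    · exact hnext ▸ Set.subset_insert e I
    · exact hprev ▸ Set.subset_insert f I
  obtain ⟨w, hw⟩ := T.exists_insert_eq_preimage he hnext hI
  refine ⟨w, _, surrounds_of_insert_eq_preimage hw, fun c' => ?_⟩
  obtain rfl | rfl | rfl := c.eq_or_eq_next_or_eq_prev c'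
  · have htail : w c' ∈ T.edge c' ⁻¹' D := (hw c').2 ▸ Set.mem_insert _ _
    refine h.mem_next_of_tail_mem_cutOff htail fun hhead => (hw c').1 ⟨hhead, fun hwe => ?_⟩
    exact h.tail_notMem_cutOff (show e ∈ T.edge c' ⁻¹' D from hwe ▸ htail)
  · rw [(Set.insert_inj (hw _).1).1 ((hw _).2.trans hnext.symm), Color.next_next]
    exact h.mem_prev
  · rw [(Set.insert_inj (hw _).1).1 ((hw _).2.trans hprev.symm), Color.next_prev]
    exact h.mem

theorem exists_rematch (s : T.State) {w : Color → W} (hw : T.IsTriangle w)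
    (hs : ∀ c, w c ∈ s.arrows c.next) :
    ∃ t : T.State, (∀ c, w c ∈ t.arrows c.prev) ∧
      ∀ u, (∀ c, u.1 ≠ w c) → t.matching u = s.matching u := by
  have w_injective : Function.Injective w := fun c c' h =>
    Color.nextPerm.injective (s.color_unique (hs c) (by rw [h]; exact hs c'))
  let v : Color ↪ {u : W // u ≠ T.outer} :=
    ⟨fun c => ⟨w c, s.ne_outer (hs c)⟩, fun c c' h => w_injective (congrArg Subtype.val h)⟩
  let σ := Color.nextPerm.viaEmbedding v
  have matching_v (c : Color) : (s.matching (σ (v c))).1 = T.vertex c.prev (w c) := by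
    have hrot : σ (v c) = v c.next := Color.nextPerm.viaEmbedding_apply v c
    have hvertex := hw c.prev
    rw [Color.next_prev, Color.prev_prev] at hvertex
    rw [hrot, hvertex, ← Color.next_next]
    exact (hs c.next).2
  have matching_of_ne {u : {u : W // u ≠ T.outer}} (hu : ∀ c, u.1 ≠ w c) :
      s.matching (σ u) = s.matching u :=
    congrArg _ (Color.nextPerm.viaEmbedding_apply_of_notMem v u fun ⟨c, hc⟩ =>
      hu c (congrArg Subtype.val hc).symm)
  refine ⟨⟨σ.trans s.matching, fun u => ?_⟩, fun c => ⟨(v c).2, matching_v c⟩,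
    fun u => matching_of_ne⟩
  by_cases hu : ∃ c, u = v c
  · obtain ⟨c, rfl⟩ := hu
    exact ⟨c.prev, matching_v c⟩
  · rw [Equiv.trans_apply, matching_of_ne fun c hc => hu ⟨c, Subtype.ext hc⟩]
    exact s.incident u

end State

end PlanarTrinity

theorem proposition4p7 {W B : Type*} (T : PlanarTrinity W B) (s : T.State) (c : Color)
    (h : s.arrows c ≠ T.clocked c) : ∃ t : T.State, PlanarTrinity.ClockwiseMove s t := by
  obtain ⟨e, f, hef, hmin⟩ := PlanarTrinity.State.exists_deviates_minimal h
  obtain ⟨w, D, hD, hs⟩ := hef.exists_surrounds hmin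
  obtain ⟨t, ht, hother⟩ := s.exists_rematch hD.isTriangle hs
  exact ⟨t, w, hD.isTriangle, ⟨D, hD⟩, fun c' => ⟨hs c', ht c'⟩, hother⟩
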